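/- **Conventions.** Let $0\le N\le M$. A Young diagram in the $N\times(M-N)$ rectangle is described by its southeast boundary path from the top right to the bottom left corner, whose $M$ steps are labelled $1,\dots,M$. The labels $i_1<\dots<i_N$ of the vertical steps label the rows, and the labels of the horizontal steps label the columns, increasing from right to left. The box in row $k$ and in the column labelled $j$ (which exists iff $j\notin\{i_1,\dots,i_N\}$ and $j>i_k$) is denoted $(i_k,j)$. A *Le-diagram* is a Young diagram with dots in some boxes such that, for every dot, either all boxes to its left contain dots or all boxes above it contain dots. It is *irreducible* if every row and every column contains an empty box (a box without a dot). The *Le-network* of a Le-diagram $L$ has the empty boxes as its vertices; a horizontal edge goes from each empty box to the next empty box to its left, and a vertical edge to the next empty box below it; a source edge enters each row $k$ from the right at its rightmost empty box, and a sink edge leaves each column $j$ at its lowest empty box. Give every empty box $b$ a weight $w_b>0$; the weight of a path from the source of row $k$ to the sink of column $j$ is the product of the $w_b$ over the boxes $b$ that it enters horizontally (through a horizontal edge or the source edge). The $N\times M$ matrix $B$ with $B_{k,i_s}=\delta_{ks}$ and, for $j\notin\{i_1,\dots,i_N\}$, $B_{k,j}=(-1)^{\#\{s\,:\,i_k<i_s<j\}}\cdot(\text{sum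 of the weights of all paths from row }k\text{ to column }j)$ represents a point of $\mathrm{Gr}(N,M)_{\ge0}$ (all its maximal minors are nonnegative), and the points *corresponding* to $L$ are those obtained for all choices of the positive weights. **Proposition.** Let $L$ be an irreducible Le-diagram and let $A$ be a real $N\times M$ matrix of rank $N$ in reduced row echelon form with nonnegative maximal minors whose row space is a point of $\mathrm{Gr}(N,M)_{\ge0}$ corresponding to $L$. Let $(i_k,j)$ be a box containing a dot, whose southeast corner is a point of the southeast boundary path. Then all boxes to the left of $(i_k,j)$ contain dots, or all boxes above it contain dots, and: (a) If all boxes to the left of $(i_k,j)$ contain dots, then $A_{k,\bullet}=(0,\dots,0,1,\dots,*,0,\dots,0)$ with the pivot $1$ in column $i_k$ (so $A_{k,i_k}=1$ and $A_{k,l}=0$ for $l<i_k$), and $A_{k,l}=0$ for all $j\le l\le M$. More precisely, let $c$ be the column of the leftmost empty box of row $k$. Then $c<j$, the last nonzero entry "$*$" of row $k$ is at $(k,c)$, that is, $A_{k,c}\ne0$ and $A_{k,l}=0$ for all $l>c$. In particular, if there is a box $(i_k,j-1)$ and it is empty, then $A_{k,j-1}\neq0$. (b) If all boxes above $(i_k,j)$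 contain dots, then $(A_{\bullet,j})^T=(0,\dots,0,*,\dots)$ with $A_{l,j}=0$ for all $1\le l\le k$. More precisely, let $r$ be the row of the topmost empty box of column $j$. Then $r>k$, $A_{r,j}\ne0$, and $A_{l,j}=0$ for all $l<r$. -/

import Mathlib

open scoped BigOperators

noncomputable section

/- Rows of an `N × M` matrix are indexed by `Fin N`, columns by `Fin M`, so every index here is the
usual one minus `1`.  A Young diagram in the `N × (M - N)` rectangle is given by the labels
`p 0 < p 1 < ⋯` of the vertical steps of its southeast boundary path, read from the top right to the
bottom left corner.  Its row `k` carries the label `p k`; its columns carry the remaining labels,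
increasing from right to left.  The box in row `k` and in the column labelled `j` is `(k, j)`. -/

/-- `(k, j)` is a box of the Young diagram with vertical boundary steps `p`. -/
def IsBox {N M : ℕ} (p : Fin N ↪o Fin M) (k : Fin N) (j : Fin M) : Prop :=
  j ∉ Set.range p ∧ p k < j

/-- A Le-diagram: a Young diagram with dots in some boxes such that, for every dot, all boxes to its
left are dotted or all boxes above it are dotted. -/
structure LeDiagram (N M : ℕ) where
  pivot : Fin N ↪o Fin M
  dot : Fin N → Fin M → Prop
  isBox_of_dot : ∀ k j, dot k j → IsBox pivot k j
  le_property : ∀ k j, dot k j →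
    (∀ l, j < l → IsBox pivot k l → dot k l) ∨ (∀ r, r < k → IsBox pivot r j → dot r j)

namespace LeDiagram

variable {N M : ℕ} (L : LeDiagram N M)

/-- `(k, j)` is an empty box. -/
def Blank (k : Fin N) (j : Fin M) : Prop := IsBox L.pivot k j ∧ ¬ L.dot k j

/-- Every row and every column contains an empty box. -/
def Irreducible : Prop :=
  (∀ k, ∃ j, L.Blank k j) ∧ (∀ j, j ∉ Set.range L.pivot → ∃ k, L.Blank k j)

/-! Lattice points are written `(x, y)`: `x` counts columns from the left edge, `y` counts rows from
the top edge of the `N × (M - N)` rectangle. -/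

open Classical in
/-- The lattice point reached after `t` steps of the southeast boundary path: `x` is the number of
horizontal steps still to come, `y` the number of vertical steps made. -/
def boundaryPoint (t : ℕ) : ℕ × ℕ :=
  ((Finset.univ.filter fun l : Fin M => l ∉ Set.range L.pivot ∧ t ≤ (l : ℕ)).card,
   (Finset.univ.filter fun r : Fin N => (L.pivot r : ℕ) < t).card)

open Classical in
/-- The southeast corner of the box `(k, j)`. -/
def southeastCorner (k : Fin N) (j : Fin M) : ℕ × ℕ :=
  ((Finset.univ.filter fun l : Fin M => l ∉ Set.range L.pivot ∧ j ≤ l).card, (k : ℕ) + 1)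

/-- The southeast corner of the box `(k, j)` is a point of the southeast boundary path. -/
def CornerOnBoundary (k : Fin N) (j : Fin M) : Prop :=
  ∃ t : ℕ, t ≤ M ∧ L.boundaryPoint t = L.southeastCorner k j

/-! ### The Le-network

The vertices are the empty boxes.  A horizontal edge goes from an empty box to the next empty box to
its left, a vertical edge to the next empty box below it; a source edge enters each row at its right
end, a sink edge leaves each column at its bottom. -/

/-- `b'` is the next empty box to the left of `b`. -/
def HorizontalEdge (b b' : Fin N × Fin M) : Prop :=
  L.Blank b.1 b.2 ∧ L.Blank b'.1 b'.2 ∧ b'.1 = b.1 ∧ b.2 < b'.2 ∧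
    ∀ l, b.2 < l → l < b'.2 → ¬ L.Blank b.1 l

/-- `b'` is the next empty box below `b`. -/
def VerticalEdge (b b' : Fin N × Fin M) : Prop :=
  L.Blank b.1 b.2 ∧ L.Blank b'.1 b'.2 ∧ b'.2 = b.2 ∧ b.1 < b'.1 ∧
    ∀ r, b.1 < r → r < b'.1 → ¬ L.Blank r b.2

/-- `b` is the rightmost empty box of row `k`. -/
def SourceEdge (k : Fin N) (b : Fin N × Fin M) : Prop :=
  b.1 = k ∧ L.Blank b.1 b.2 ∧ ∀ l, l < b.2 → ¬ L.Blank k l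

/-- `b` is the lowest empty box of column `j`. -/
def SinkEdge (b : Fin N × Fin M) (j : Fin M) : Prop :=
  b.2 = j ∧ L.Blank b.1 b.2 ∧ ∀ r, b.1 < r → ¬ L.Blank r j

/-- The `n + 1` boxes `v 0, …, v n` are the successive vertices of a directed path from the source of
row `k` to the sink of column `j`. -/
def IsPath (k : Fin N) (j : Fin M) (n : ℕ) (v : Fin (n + 1) → Fin N × Fin M) : Prop :=
  L.SourceEdge k (v 0) ∧
    (∀ i : Fin n, L.HorizontalEdge (v i.castSucc) (v i.succ) ∨
      L.VerticalEdge (v i.castSucc) (v i.succ)) ∧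
    L.SinkEdge (v (Fin.last n)) j

open Classical in
/-- The weight of a path: the product of the weights of its horizontal edges, the source edge
included; `w b` is the weight of the horizontal edge that enters the box `b`. -/
def pathWeight (w : Fin N × Fin M → ℝ) (n : ℕ) (v : Fin (n + 1) → Fin N × Fin M) : ℝ :=
  w (v 0) * ∏ i : Fin n, if L.HorizontalEdge (v i.castSucc) (v i.succ) then w (v i.succ) else 1

open Classical in
/-- The sum of the weights of all paths from the source of row `k` to the sink of column `j`.  Every
edge goes to the left or down, so that a path has fewer than `N + M` edges between boxes. -/
def pathSum (w : Fin N × Fin M → ℝ) (k : Fin N) (j : Fin M) : ℝ :=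
  ∑ n ∈ Finset.range (N + M),
    ∑ v ∈ Finset.univ.filter (fun v : Fin (n + 1) → Fin N × Fin M => L.IsPath k j n v),
      L.pathWeight w n v

open Classical in
/-- The boundary measurement matrix of the weighted Le-network: the identity in the columns of the
pivots, and signed sums over paths in the other columns, the sign being given by the number of pivots
strictly between the source and the sink. -/
def networkMatrix (w : Fin N × Fin M → ℝ) : Matrix (Fin N) (Fin M) ℝ := fun k j =>
  if j ∈ Set.range L.pivot then (if L.pivot k = j then 1 else 0)
  else (-1) ^ (Finset.univ.filter fun s : Fin N => L.pivot k < L.pivot s ∧ L.pivot s < j).card *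
    L.pathSum w k j

/-- The row space of `A` is the point of the Grassmannian that the Le-diagram `L` parametrizes for
some choice of positive weights of the empty boxes. -/
def Parametrizes (A : Matrix (Fin N) (Fin M) ℝ) : Prop :=
  ∃ w : Fin N × Fin M → ℝ, (∀ b, L.Blank b.1 b.2 → 0 < w b) ∧
    Submodule.span ℝ (Set.range A.row) = Submodule.span ℝ (Set.range (L.networkMatrix w).row)

end LeDiagram

/-- `A` has rank `N` and is in reduced row echelon form. -/
def IsRREF {N M : ℕ} (A : Matrix (Fin N) (Fin M) ℝ) : Prop :=
  ∃ p : Fin N ↪o Fin M, (∀ k, A k (p k) = 1) ∧ (∀ k l, l ≠ k → A l (p k) = 0) ∧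
    ∀ k j, j < p k → A k j = 0

/-- All maximal minors of `A` are nonnegative. -/
def IsTNN {N M : ℕ} (A : Matrix (Fin N) (Fin M) ℝ) : Prop :=
  ∀ s : Fin N ↪o Fin M, 0 ≤ (A.submatrix id s).det

end

/-! A reduced row echelon form is determined by its row space, and the network matrix is one, so `A`
equals it. A nonpivot entry is a sign depending only on its position times a sum of positive path
weights; nothing cancels, so it vanishes exactly when no path joins the row to the column. An empty
box always carries such a path: go left along its row to the box, then down its column. The
vanishing is planar. If the southeast corner of `(k, j)` is on the boundary, no box below row `k`
lies to the right of column `j` (`CornerOnBoundary.le_of_isBox`). In (a) the empty boxes of row `k`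
all lie to the right of column `j`, so a path from row `k` can never step down. In (b) the empty
boxes of column `j` all lie below row `k`, so a path ending in this column can never enter it from
the right. -/

/-! ### Reduced row echelon forms -/

/-- `A` is in reduced row echelon form with pivots in the columns `p k`. -/
def IsRREFWith {N M : ℕ} (A : Matrix (Fin N) (Fin M) ℝ) (p : Fin N ↪o Fin M) : Prop :=
  (∀ k, A k (p k) = 1) ∧ (∀ k l, l ≠ k → A l (p k) = 0) ∧ ∀ k j, j < p k → A k j = 0

namespace IsRREFWith

variable {N M : ℕ} {A B : Matrix (Fin N) (Fin M) ℝ} {p q : Fin N ↪o Fin M}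

theorem sum_apply_pivot (hA : IsRREFWith A p) (c : Fin N → ℝ) (s : Fin N) :
    (∑ k, c k • A.row k) (p s) = c s := by
  rw [Finset.sum_apply, Finset.sum_eq_single s]
  · simp [Matrix.row, hA.1]
  · intro k _ hk
    simp [Matrix.row, hA.2.1 s k hk]
  · simp

theorem eq_sum_of_mem_span (hA : IsRREFWith A p) {v : Fin M → ℝ}
    (hv : v ∈ Submodule.span ℝ (Set.range A.row)) : v = ∑ k, v (p k) • A.row k := by
  obtain ⟨c, rfl⟩ := (Submodule.mem_span_range_iff_exists_fun ℝ).1 hv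
  simp_rw [hA.sum_apply_pivot]

/-- The leading entry of a vector of the row space lies in a pivot column. -/
theorem mem_range_of_leading (hA : IsRREFWith A p) {v : Fin M → ℝ}
    (hv : v ∈ Submodule.span ℝ (Set.range A.row)) {j : Fin M} (hj : v j ≠ 0)
    (hlt : ∀ l, l < j → v l = 0) : j ∈ Set.range p := by
  by_contra hjp
  apply hj
  rw [hA.eq_sum_of_mem_span hv, Finset.sum_apply]
  refine Finset.sum_eq_zero fun k _ => ?_
  -- Pivots before `j` have coefficient `v (p k) = 0`; rows with a later pivot vanish at `j`.
  rcases lt_trichotomy (p k) j with h | h | h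
  · simp [hlt _ h]
  · exact absurd ⟨k, h⟩ hjp
  · simp [Matrix.row, hA.2.2 k j h]

theorem range_subset (hA : IsRREFWith A p) (hB : IsRREFWith B q)
    (h : Submodule.span ℝ (Set.range A.row) = Submodule.span ℝ (Set.range B.row)) :
    Set.range p ⊆ Set.range q := by
  rintro _ ⟨k, rfl⟩
  refine hB.mem_range_of_leading (v := A.row k) (h ▸ Submodule.subset_span ⟨k, rfl⟩) ?_ ?_
  · simp [Matrix.row, hA.1]
  · exact fun l hl => hA.2.2 k l hl

/-- A reduced row echelon form is determined by its row space. -/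
theorem unique (hA : IsRREFWith A p) (hB : IsRREFWith B q)
    (h : Submodule.span ℝ (Set.range A.row) = Submodule.span ℝ (Set.range B.row)) :
    A = B := by
  have hpq : p = q := OrderEmbedding.range_inj.1
    ((hA.range_subset hB h).antisymm (hB.range_subset hA h.symm))
  subst hpq
  ext k j
  have hk := hB.eq_sum_of_mem_span (v := A.row k) (h ▸ Submodule.subset_span ⟨k, rfl⟩)
  have := congrFun hk j
  rw [Finset.sum_apply, Finset.sum_eq_single k] at this
  · simpa [Matrix.row, hA.1] using this
  · intro s _ hs
    simp [Matrix.row, hA.2.1 s k hs.symm]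
  · simp

end IsRREFWith

/-- Vertices related by the reflexive transitive closure of `R` are joined by a finite walk. -/
theorem Relation.ReflTransGen.exists_walk {α : Type*} {R : α → α → Prop} {a b : α}
    (h : Relation.ReflTransGen R a b) :
    ∃ (n : ℕ) (v : Fin (n + 1) → α), v 0 = a ∧ (∀ i : Fin n, R (v i.castSucc) (v i.succ)) ∧
      v (Fin.last n) = b := by
  induction h using Relation.ReflTransGen.head_induction_on with
  | refl => exact ⟨0, fun _ => b, rfl, fun i => i.elim0, rfl⟩
  | @head a c hac _ ih =>
    obtain ⟨n, v, h0, hs, hl⟩ := ih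
    refine ⟨n + 1, Fin.cons a v, rfl, fun i => ?_, ?_⟩
    · refine Fin.cases ?_ (fun i => ?_) i
      · simpa [h0] using hac
      · have := hs i
        rwa [← Fin.succ_castSucc, Fin.cons_succ, Fin.cons_succ]
    · rw [← Fin.succ_last, Fin.cons_succ, hl]

open Classical in
/-- In a finite linear order, one moves from an element satisfying `P` to any larger one by passing
repeatedly to the next element satisfying `P`. -/
theorem reflTransGen_next {α : Type*} [LinearOrder α] [LocallyFiniteOrder α] {P : α → Prop}
    {a b : α} (ha : P a) (hb : P b) (hab : a ≤ b) :
    Relation.ReflTransGen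
      (fun x y => P x ∧ P y ∧ x < y ∧ ∀ l, x < l → l < y → ¬ P l) a b := by
  have h : Relation.ReflTransGen (· ⋖ ·) (⟨a, ha⟩ : Subtype P) ⟨b, hb⟩ :=
    le_iff_reflTransGen_covBy.1 hab
  refine h.lift (fun x : Subtype P => (x : α)) fun x y hxy => ⟨x.2, y.2, hxy.1, fun l h1 h2 hl => ?_⟩
  exact hxy.2 (c := ⟨l, hl⟩) h1 h2

namespace LeDiagram

variable {N M : ℕ} {L : LeDiagram N M} {k : Fin N} {j : Fin M}

/-! ### Paths in the Le-network -/

namespace IsPath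

variable {n : ℕ} {v : Fin (n + 1) → Fin N × Fin M}

theorem blank (hv : L.IsPath k j n v) (i : Fin (n + 1)) : L.Blank (v i).1 (v i).2 := by
  refine Fin.cases hv.1.2.1 (fun i => ?_) i
  rcases hv.2.1 i with h | h
  · exact h.2.1
  · exact h.2.1

/-- Every edge raises the row index or the column label. Hence the cutoff `N + M` in `pathSum` loses
no path. -/
theorem add_le (hv : L.IsPath k j n v) (i : Fin (n + 1)) :
    (i : ℕ) ≤ (v i).1 + (v i).2 := by
  induction i using Fin.induction with
  | zero => simp
  | succ i ih =>
    rcases hv.2.1 i with ⟨-, -, h1, h2, -⟩ | ⟨-, -, h1, h2, -⟩ <;>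
      rw [Fin.lt_def] at h2 <;> rw [h1] <;> simp at ih ⊢ <;> omega

theorem length_lt (hv : L.IsPath k j n v) : n < N + M := by
  have h := hv.add_le (Fin.last n)
  have h1 := (v (Fin.last n)).1.2
  have h2 := (v (Fin.last n)).2.2
  simp at h
  omega

theorem snd_zero_le (hv : L.IsPath k j n v) (i : Fin (n + 1)) : (v 0).2 ≤ (v i).2 := by
  induction i using Fin.induction with
  | zero => exact le_rfl
  | succ i ih =>
    rcases hv.2.1 i with ⟨-, -, -, h, -⟩ | ⟨-, -, h, -, -⟩
    · exact ih.trans h.le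
    · exact ih.trans h.ge

/-- The column of the sink of a path is to the left of the vertical step of its source. -/
theorem pivot_lt (hv : L.IsPath k j n v) : L.pivot k < j := by
  have h := hv.1.2.1.1.2
  rw [hv.1.1] at h
  exact h.trans_le ((hv.snd_zero_le (Fin.last n)).trans hv.2.2.1.le)

theorem weight_pos {w : Fin N × Fin M → ℝ} (hw : ∀ b, L.Blank b.1 b.2 → 0 < w b)
    (hv : L.IsPath k j n v) : 0 < L.pathWeight w n v := by
  refine mul_pos (hw _ (hv.blank 0)) (Finset.prod_pos fun i _ => ?_)
  split_ifs with h
  · exact hw _ (hv.blank _)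
  · exact one_pos

end IsPath

open Classical in
theorem pathSum_eq_zero (w : Fin N × Fin M → ℝ) (h : ∀ n v, ¬ L.IsPath k j n v) :
    L.pathSum w k j = 0 := by
  refine Finset.sum_eq_zero fun n _ => ?_
  rw [Finset.filter_false_of_mem fun v _ => h n v, Finset.sum_empty]

open Classical in
theorem pathSum_pos {w : Fin N × Fin M → ℝ} (hw : ∀ b, L.Blank b.1 b.2 → 0 < w b)
    {n : ℕ} {v : Fin (n + 1) → Fin N × Fin M} (hv : L.IsPath k j n v) :
    0 < L.pathSum w k j := by
  have hpos : ∀ m, ∀ u ∈ Finset.univ.filter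
      (fun u : Fin (m + 1) → Fin N × Fin M => L.IsPath k j m u), 0 < L.pathWeight w m u :=
    fun m u hu => (Finset.mem_filter.1 hu).2.weight_pos hw
  refine Finset.sum_pos' (fun m _ => Finset.sum_nonneg fun u hu => (hpos m u ?_).le)
    ⟨n, Finset.mem_range.2 hv.length_lt, Finset.sum_pos (fun u hu => hpos n u ?_) ⟨v, ?_⟩⟩
  · simpa using hu
  · simpa using hu
  · simpa using hv

theorem Blank.reflTransGen_row {c : Fin M} (hc : L.Blank k c) (hj : L.Blank k j) (h : c ≤ j) :
    Relation.ReflTransGen (fun b b' => L.HorizontalEdge b b' ∨ L.VerticalEdge b b')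
      (k, c) (k, j) :=
  (reflTransGen_next (P := L.Blank k) hc hj h).lift (fun x => (k, x)) fun _ _ hxy =>
    Or.inl ⟨hxy.1, hxy.2.1, rfl, hxy.2.2.1, hxy.2.2.2⟩

theorem Blank.reflTransGen_col {r : Fin N} (hk : L.Blank k j) (hr : L.Blank r j) (h : k ≤ r) :
    Relation.ReflTransGen (fun b b' => L.HorizontalEdge b b' ∨ L.VerticalEdge b b')
      (k, j) (r, j) :=
  (reflTransGen_next (P := fun s => L.Blank s j) hk hr h).lift (fun x => (x, j)) fun _ _ hxy =>
    Or.inr ⟨hxy.1, hxy.2.1, rfl, hxy.2.2.1, hxy.2.2.2⟩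

/-- Through an empty box `(k, j)` runs a path from the source of its row to the sink of its
column. -/
theorem Blank.exists_isPath (h : L.Blank k j) : ∃ n v, L.IsPath k j n v := by
  classical
  -- Labels increase to the left, so the minimal `c` is the rightmost empty box, where the source
  -- edge enters.
  obtain ⟨c, hc⟩ := (Set.toFinite {c | L.Blank k c}).exists_minimal ⟨j, h⟩
  obtain ⟨r, hr⟩ := (Set.toFinite {r | L.Blank r j}).exists_maximal ⟨k, h⟩
  have hcl : ∀ l, l < c → ¬ L.Blank k l := fun l hl hb => hc.not_lt hb hl
  have hrl : ∀ s, r < s → ¬ L.Blank s j := fun s hs hb => hr.not_gt hb hs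
  have hcj : c ≤ j := not_lt.1 fun hlt => hcl j hlt h
  have hkr : k ≤ r := not_lt.1 fun hlt => hrl k hlt h
  obtain ⟨n, v, h0, hs, hl⟩ :=
    ((Blank.reflTransGen_row hc.prop h hcj).trans (Blank.reflTransGen_col h hr.prop hkr)).exists_walk
  refine ⟨n, v, ?_, hs, ?_⟩
  · rw [h0]
    exact ⟨rfl, hc.prop, hcl⟩
  · rw [hl]
    exact ⟨rfl, hr.prop, hrl⟩

/-! ### The boundary measurement matrix -/

theorem networkMatrix_pivot (w : Fin N × Fin M → ℝ) (k s : Fin N) :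
    L.networkMatrix w k (L.pivot s) = if k = s then 1 else 0 := by
  simp [networkMatrix]

theorem networkMatrix_eq_zero (w : Fin N × Fin M → ℝ) (hk : L.pivot k ≠ j)
    (h : ∀ n v, ¬ L.IsPath k j n v) : L.networkMatrix w k j = 0 := by
  simp only [networkMatrix, hk, if_false, pathSum_eq_zero w h, mul_zero, ite_self]

theorem networkMatrix_ne_zero {w : Fin N × Fin M → ℝ} (hw : ∀ b, L.Blank b.1 b.2 → 0 < w b)
    (h : L.Blank k j) : L.networkMatrix w k j ≠ 0 := by
  obtain ⟨n, v, hv⟩ := h.exists_isPath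
  rw [networkMatrix, if_neg h.1.1]
  exact mul_ne_zero (pow_ne_zero _ (by norm_num)) (pathSum_pos hw hv).ne'

theorem isRREFWith_networkMatrix (w : Fin N × Fin M → ℝ) :
    IsRREFWith (L.networkMatrix w) L.pivot := by
  refine ⟨fun k => ?_, fun k l hl => ?_, fun k j hj => ?_⟩
  · rw [networkMatrix_pivot, if_pos rfl]
  · rw [networkMatrix_pivot, if_neg hl]
  · exact networkMatrix_eq_zero w hj.ne' fun n v hv => hv.pivot_lt.not_gt hj

/-! ### Paths near a corner on the boundary -/

/-- If the southeast corner of `(k, j)` is on the boundary path, then the boxes in the rows below `k`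
are weakly to the left of the column `j`. -/
theorem CornerOnBoundary.le_of_isBox (hc : L.CornerOnBoundary k j)
    {r : Fin N} {l : Fin M} (hr : k < r) (hb : IsBox L.pivot r l) : j ≤ l := by
  classical
  obtain ⟨t, -, ht⟩ := hc
  simp only [boundaryPoint, southeastCorner, Prod.mk.injEq] at ht
  obtain ⟨hx, hy⟩ := ht
  -- By `hy` exactly `k + 1` pivots precede step `t`; were `pivot r` among them, there would be at
  -- least `r + 1 > k + 1`.
  have htr : t ≤ (L.pivot r : ℕ) := by
    by_contra! hlt
    have hsub : Finset.Iic r ⊆ Finset.univ.filter fun s : Fin N => (L.pivot s : ℕ) < t := by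
      intro s hs
      have : L.pivot s ≤ L.pivot r := L.pivot.monotone (Finset.mem_Iic.1 hs)
      rw [Fin.le_def] at this
      simp only [Finset.mem_filter, Finset.mem_univ, true_and]
      omega
    have := Finset.card_le_card hsub
    rw [hy, Fin.card_Iic] at this
    rw [Fin.lt_def] at hr
    omega
  by_contra! hlj
  have hrl := hb.2
  rw [Fin.lt_def] at hrl hlj
  -- Now `t ≤ pivot r < l < j`, so `l` is counted from `t` on but not from `j` on, against `hx`.
  have hss : (Finset.univ.filter fun m : Fin M => m ∉ Set.range L.pivot ∧ j ≤ m) ⊂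
      Finset.univ.filter fun m : Fin M => m ∉ Set.range L.pivot ∧ t ≤ (m : ℕ) := by
    refine Finset.ssubset_iff_subset_ne.2 ⟨fun m hm => ?_, fun he => ?_⟩
    · simp only [Finset.mem_filter, Finset.mem_univ, true_and, Fin.le_def] at hm ⊢
      exact ⟨hm.1, by omega⟩
    · have : l ∈ Finset.univ.filter fun m : Fin M => m ∉ Set.range L.pivot ∧ t ≤ (m : ℕ) := by
        simp only [Finset.mem_filter, Finset.mem_univ, true_and]
        exact ⟨hb.1, by omega⟩
      rw [← he] at this
      simp only [Finset.mem_filter, Finset.mem_univ, true_and, Fin.le_def] at this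
      omega
  exact absurd hx (Finset.card_lt_card hss).ne'

/-- A path from row `k` does not get beyond the leftmost empty box of this row, provided that this box
is to the right of a box `(k, j)` whose southeast corner is on the boundary path. -/
theorem IsPath.le_of_cornerOnBoundary (hc : L.CornerOnBoundary k j)
    {c l : Fin M} (hcj : c < j) (hmax : ∀ m, L.Blank k m → m ≤ c)
    {n : ℕ} {v : Fin (n + 1) → Fin N × Fin M} (hv : L.IsPath k l n v) : l ≤ c := by
  have hrow : ∀ i, (v i).1 = k := by
    intro i
    induction i using Fin.induction with
    | zero => exact hv.1.1
    | succ i ih =>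
      rcases hv.2.1 i with ⟨-, -, h, -, -⟩ | ⟨hb, hb', h, hlt, -⟩
      · rw [h, ih]
      · rw [ih] at hlt hb
        -- A downward step would land below row `k` in a column at or left of `j`, but it starts at
        -- an empty box of row `k`, hence right of `j`.
        have h1 := hc.le_of_isBox hlt hb'.1
        rw [h] at h1
        exact absurd (h1.trans (hmax _ hb)) hcj.not_ge
  have := hv.blank (Fin.last n)
  rw [hrow, hv.2.2.1] at this
  exact hmax _ this

/-- If the southeast corner of `(k, j)` is on the boundary path and all empty boxes of column `j` are
below row `k`, then a path to column `j` starts in this column. -/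
theorem IsPath.blank_of_cornerOnBoundary (hc : L.CornerOnBoundary k j)
    (hmin : ∀ s, L.Blank s j → k < s) {l : Fin N}
    {n : ℕ} {v : Fin (n + 1) → Fin N × Fin M} (hv : L.IsPath l j n v) : L.Blank l j := by
  have hcol : ∀ i, (v i).2 = j := by
    intro i
    -- Only the end of the path is known to lie in column `j`, so it is traced backwards.
    induction i using Fin.reverseInduction with
    | last => exact hv.2.2.1
    | cast i ih =>
      rcases hv.2.1 i with ⟨hb, hb', h, hlt, -⟩ | ⟨-, -, h, -, -⟩
      · rw [ih] at hlt hb'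
        have hk := hmin _ hb'
        rw [h] at hk
        exact absurd (hc.le_of_isBox hk hb.1) hlt.not_ge
      · rw [← h, ih]
  have := hv.blank 0
  rwa [hcol, hv.1.1] at this

end LeDiagram

theorem mainTheorem4 {N M : ℕ} (L : LeDiagram N M) (hL : L.Irreducible)
    (A : Matrix (Fin N) (Fin M) ℝ) (hRREF : IsRREF A) (hTNN : IsTNN A) (hA : L.Parametrizes A)
    (k : Fin N) (j : Fin M) (hdot : L.dot k j) (hcorner : L.CornerOnBoundary k j) :
    -- one of the two cases occurs
    ((∀ l, j < l → IsBox L.pivot k l → L.dot k l) ∨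
      (∀ r, r < k → IsBox L.pivot r j → L.dot r j)) ∧
    -- (a) all boxes to the left of the dot are dotted
    ((∀ l, j < l → IsBox L.pivot k l → L.dot k l) →
      A k (L.pivot k) = 1 ∧
      (∀ l, l < L.pivot k → A k l = 0) ∧
      (∀ l, j ≤ l → A k l = 0) ∧
      (∀ c : Fin M, (c : ℕ) + 1 = (j : ℕ) → L.Blank k c → A k c ≠ 0) ∧
      (∃ c, c < j ∧ L.Blank k c ∧ (∀ l, c < l → IsBox L.pivot k l → L.dot k l) ∧
        A k c ≠ 0 ∧ ∀ l, c < l → A k l = 0)) ∧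
    -- (b) all boxes above the dot are dotted
    ((∀ r, r < k → IsBox L.pivot r j → L.dot r j) →
      (∀ l, l ≤ k → A l j = 0) ∧
      (∃ r, k < r ∧ L.Blank r j ∧ (∀ l, l < r → IsBox L.pivot l j → L.dot l j) ∧
        A r j ≠ 0 ∧ ∀ l, l < r → A l j = 0)) := by
  obtain ⟨w, hw, hspan⟩ := hA
  obtain ⟨p, hp⟩ := hRREF
  have hAB : A = L.networkMatrix w :=
    IsRREFWith.unique (p := p) hp (LeDiagram.isRREFWith_networkMatrix w) hspan
  have hbox := L.isBox_of_dot k j hdot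
  have hB := LeDiagram.isRREFWith_networkMatrix (L := L) w
  rw [hAB]
  refine ⟨L.le_property k j hdot, fun hleft => ?_, fun habove => ?_⟩
  -- Irreducibility supplies an empty box; the maximal label is the leftmost one.
  · obtain ⟨c, hc⟩ := (Set.toFinite {c | L.Blank k c}).exists_maximal (hL.1 k)
    have hcb : L.Blank k c := hc.prop
    have hmax : ∀ m, L.Blank k m → m ≤ c := fun m hm => not_lt.1 fun h => hc.not_gt hm h
    have hlt : ∀ m, L.Blank k m → m < j := fun m hm => by
      rcases lt_trichotomy m j with h | h | h
      · exact h
      · exact absurd (h ▸ hdot) hm.2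
      · exact absurd (hleft m h hm.1) hm.2
    have hzero : ∀ l, c < l → L.networkMatrix w k l = 0 := fun l hl =>
      LeDiagram.networkMatrix_eq_zero w (hcb.1.2.trans hl).ne fun n v hv =>
        hl.not_ge (hv.le_of_cornerOnBoundary hcorner (hlt c hcb) hmax)
    refine ⟨hB.1 k, hB.2.2 k, fun l hl => hzero l ((hlt c hcb).trans_le hl),
      fun d _ hd => LeDiagram.networkMatrix_ne_zero hw hd,
      c, hlt c hcb, hcb, fun l hl hb => ?_, LeDiagram.networkMatrix_ne_zero hw hcb, hzero⟩
    by_contra hnd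
    exact hl.not_ge (hmax l ⟨hb, hnd⟩)
  · obtain ⟨r, hr⟩ := (Set.toFinite {r | L.Blank r j}).exists_minimal (hL.2 j hbox.1)
    have hrb : L.Blank r j := hr.prop
    have hmin : ∀ s, L.Blank s j → r ≤ s := fun s hs => not_lt.1 fun h => hr.not_lt hs h
    have hgt : ∀ s, L.Blank s j → k < s := fun s hs => by
      rcases lt_trichotomy s k with h | h | h
      · exact absurd (habove s h hs.1) hs.2
      · exact absurd (h ▸ hdot) hs.2
      · exact h
    have hzero : ∀ l, l < r → L.networkMatrix w l j = 0 := fun l hl =>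
      LeDiagram.networkMatrix_eq_zero w (fun h => hbox.1 ⟨l, h⟩) fun n v hv =>
        hl.not_ge (hmin l (hv.blank_of_cornerOnBoundary hcorner hgt))
    refine ⟨fun l hl => hzero l (hl.trans_lt (hgt r hrb)), r, hgt r hrb, hrb, fun l hl hb => ?_,
      LeDiagram.networkMatrix_ne_zero hw hrb, hzero⟩
    by_contra hnd
    exact hl.not_ge (hmin l ⟨hb, hnd⟩)
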